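/- Let $B$ be a normal local ring (a local domain, integrally closed in its field of fractions; not assumed noetherian) with maximal ideal $\mathfrak m_B$ and residue field $k_B=B/\mathfrak m_B$. Let $p$ be a prime number and let $G$ be a group of order $p$ acting faithfully on $B$ by (local) ring automorphisms. Let $A=B^G$ be the ring of invariants, which is a local ring, with residue field $k_A$. Fix a generator $\sigma$ of $G$, and let $I_G\subset B$ be the augmentation ideal, i.e. the ideal of $B$ generated by all elements $I(b)=\sigma(b)-b$ with $b\in B$ (it does not depend on the choice of $\sigma$). Consider the following conditions: (a) the ideal $I_G$ is principal; (b) $B$ is a monogenous $A$-algebra, i.e. $B=A[y]$ for some $y\in B$; (c) $B$ is a free $A$-module. Then (a) $\Leftrightarrow$ (b) and (b) $\Rightarrow$ (c). Assume in addition that $B$ is a regular local ring (in particular noetherian), and consider the conditions: (d) $A$ is a regular local ring; (e) $G$ acts as a pseudo-reflection, i.e. there is a regular system of parameters $(y_1,\dots,y_d)$ of $B$ (with $d=\dim B$ and $\mathfrak m_B=(y_1,\dots,y_d)$) such that $y_2,\dots,y_d$ are invariant under $G$. Then (c) $\Rightarrow$ (d). If, moreover, the canonical map $k_A\to k_B$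 is an isomorphism, then (a) $\Leftrightarrow$ (e). -/

import Mathlib

section GroupActionOnLocalRing

variable (G B : Type*) [Group G] [CommRing B] [MulSemiringAction G B]

/-- The ring of invariants `B^G`, as a subring of `B`. -/
abbrev InvariantRing : Subring B := FixedPoints.subring B G

/-- An invariant which is a unit in `B` is a unit in `B^G`: the inclusion is a local map. -/
instance invariantRing_isLocalHom : IsLocalHom (algebraMap (InvariantRing G B) B) where
  map_nonunit := by
    rintro ⟨a, ha⟩ hu
    obtain ⟨u, hu⟩ := hu
    have hua : (u : B) = a := hu
    have hinv : ((u⁻¹ : Bˣ) : B) ∈ InvariantRing G B := by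
      intro g
      have h1 : (u : B) * (g • ((u⁻¹ : Bˣ) : B)) = 1 := by
        have h2 : g • ((u : B) * ((u⁻¹ : Bˣ) : B)) = 1 := by
          rw [Units.mul_inv, smul_one]
        rw [smul_mul'] at h2
        have h3 : g • (u : B) = u := by rw [hua]; exact ha g
        rwa [h3] at h2
      calc g • ((u⁻¹ : Bˣ) : B)
          = ((u⁻¹ : Bˣ) : B) * ((u : B) * (g • ((u⁻¹ : Bˣ) : B))) := by
            rw [Units.inv_mul_cancel_left]
        _ = ((u⁻¹ : Bˣ) : B) := by rw [h1, mul_one]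
    refine IsUnit.of_mul_eq_one ⟨((u⁻¹ : Bˣ) : B), hinv⟩ ?_
    apply Subtype.ext
    change a * ((u⁻¹ : Bˣ) : B) = 1
    rw [← hua, Units.mul_inv]

/-- The ring of invariants of a local ring is a local ring. -/
instance invariantRing_isLocalRing [IsLocalRing B] : IsLocalRing (InvariantRing G B) :=
  RingHom.domain_isLocalRing (algebraMap (InvariantRing G B) B)

/-- The canonical map `k_A → k_B` of residue fields, for `A = B^G`. -/
noncomputable def residueFieldMap [IsLocalRing B] :
    IsLocalRing.ResidueField (InvariantRing G B) →+* IsLocalRing.ResidueField B :=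
  IsLocalRing.ResidueField.map (algebraMap (InvariantRing G B) B)

/-- `G` acts on the regular local ring `B` as a pseudo-reflection: there is a regular system of
parameters `y 0, …, y (d - 1)` (that is, `d = dim B` generators of the maximal ideal)
such that all of its members except possibly `y 0` are invariant under `G`. -/
def IsPseudoReflection [IsRegularLocalRing B] : Prop :=
  ∃ (d : ℕ) (y : Fin d → B),
    (d : WithBot ℕ∞) = ringKrullDim B ∧
    Ideal.span (Set.range y) = IsLocalRing.maximalIdeal B ∧
    ∀ i : Fin d, (i : ℕ) ≠ 0 → ∀ g : G, g • y i = y i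

variable {G}

/-- The augmentation map `I = σ - id : B → B`. -/
def augmentationMap (σ : G) (b : B) : B := σ • b - b

/-- The augmentation ideal `B · I(B)`, where `I = σ - id`. It is the augmentation ideal `I_G` when
`σ` generates `G`. -/
def augmentationIdeal (σ : G) : Ideal B := Ideal.span (Set.range (augmentationMap B σ))

end GroupActionOnLocalRing

/-- The `A`-algebra `B` is monogenous: `B = A[y]` for some `y ∈ B`. -/
def IsMonogenous (A B : Type*) [CommRing A] [CommRing B] [Algebra A B] : Prop :=
  ∃ y : B, Algebra.adjoin A {y} = ⊤

/-! ### Principal augmentation ideal and monogenous extensions -/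

section Monogenous

open Polynomial

/-! Write `I` for the augmentation ideal and `A` for the invariants. If `I` is principal, locality
yields a generator `σ y - y`, and since `p` is prime every `σ ^ k y - y` with `0 < k < p` generates
`I` too. Hence the divided differences in interpolating `σ ^ i y ↦ σ ^ i b` stay in `B`
(`exists_interpolation`). The interpolant of degree `< p` is unique, hence `σ`-invariant, so it has
coefficients in `A` and gives `b = P(y)`: the powers `1, …, y ^ (p - 1)` form an `A`-basis.
Conversely, if `B = A[y]` then `σ y - y` divides every `P(σ y) - P(y)`.

For regularity of `A`, the extension is faithfully flat and integral, so `A` is noetherian and it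
suffices that `edim A ≤ dim B ≤ dim A`. The first inequality follows Serre's argument
(`spanFinrank_maximalIdeal_le_length`): the Koszul complex on `n = edim A` minimal generators maps
to a minimal free resolution of `k_A` so that its elementary wedges stay nonzero modulo the maximal
ideal. After base change to `B` each syzygy gains one step of depth, so the syzygies vanish beyond
step `dim B`; thus `n ≤ dim B`.

For pseudo-reflections, equal residue fields give `B = A + 𝔪`. If all generators of `𝔪` but `x` are
invariant, a twisted Leibniz rule and Nakayama give `I = (σ x - x)`. Conversely, translate `y` by an
invariant into `𝔪`; constant terms in `B = A[y]` show that `y` and invariants generate `𝔪`. -/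

/-- A principal ideal of a local domain is generated by a member of any generating set. -/
theorem Ideal.exists_span_singleton_eq_of_isPrincipal {R : Type*} [CommRing R] [IsDomain R]
    [IsLocalRing R] {S : Set R} (hne : S.Nonempty) (hS : (Ideal.span S).IsPrincipal) :
    ∃ s ∈ S, Ideal.span S = Ideal.span {s} := by
  obtain ⟨x, hx⟩ := hS
  change Ideal.span S = Ideal.span {x} at hx
  by_contra! hcon
  have hle : Ideal.span S ≤ IsLocalRing.maximalIdeal R * Ideal.span {x} := by
    rw [Ideal.span_le]
    intro s hs
    obtain ⟨c, rfl⟩ := Ideal.mem_span_singleton'.1 (hx ▸ Ideal.subset_span hs)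
    refine Ideal.mul_mem_mul ?_ (Ideal.mem_span_singleton_self x)
    intro hc
    exact hcon _ hs (hx.trans (Ideal.span_singleton_mul_left_unit hc x).symm)
  have hxm : x ∈ IsLocalRing.maximalIdeal R * Ideal.span {x} :=
    hle (hx ▸ Ideal.mem_span_singleton_self x)
  obtain ⟨z, hz, hzx⟩ := Ideal.mem_mul_span_singleton.1 hxm
  have hx0 : x ≠ 0 := by
    rintro rfl
    obtain ⟨s, hs⟩ := hne
    have h0 : Ideal.span S = ⊥ := by simpa using hx
    have hs0 : s = 0 := by simpa [h0] using Ideal.subset_span hs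
    exact hcon s hs (by simp [h0, hs0])
  have : z = 1 := mul_right_cancel₀ hx0 (by rw [hzx, one_mul])
  exact (IsLocalRing.mem_maximalIdeal z).1 hz (this ▸ isUnit_one)

variable {G B : Type*} [Group G] [CommRing B] [MulSemiringAction G B]

theorem smul_sub_mem_augmentationIdeal (σ : G) (b : B) : σ • b - b ∈ augmentationIdeal B σ :=
  Ideal.subset_span ⟨b, rfl⟩

theorem pow_smul_sub_mem_augmentationIdeal (σ : G) (k : ℕ) (b : B) :
    σ ^ k • b - b ∈ augmentationIdeal B σ := by
  induction k with
  | zero => simp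
  | succ k ih =>
    have h : σ ^ (k + 1) • b - b = (σ • σ ^ k • b - σ ^ k • b) + (σ ^ k • b - b) := by
      rw [pow_succ', mul_smul]; ring
    rw [h]
    exact add_mem (smul_sub_mem_augmentationIdeal σ _) ih

theorem pow_smul_mem_augmentationIdeal (σ : G) (k : ℕ) {x : B} (hx : x ∈ augmentationIdeal B σ) :
    σ ^ k • x ∈ augmentationIdeal B σ := by
  have := add_mem (pow_smul_sub_mem_augmentationIdeal σ k x) hx
  simpa using this

theorem smul_mem_maximalIdeal [IsLocalRing B] (g : G) {x : B}
    (hx : x ∈ IsLocalRing.maximalIdeal B) : g • x ∈ IsLocalRing.maximalIdeal B := by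
  intro h
  apply hx
  have := h.map (MulSemiringAction.toRingHom G B g⁻¹)
  simpa using this

/-- If `σ y - y` generates the augmentation ideal, then so does `τ y - y` for every power `τ` of `σ`
of which `σ` is a power. -/
theorem span_pow_smul_sub_eq_augmentationIdeal [IsDomain B] [IsLocalRing B] {σ : G}
    {y : B} (hy : augmentationIdeal B σ = Ideal.span {σ • y - y}) {k l : ℕ}
    (hkl : (σ ^ k) ^ l = σ) :
    augmentationIdeal B σ = Ideal.span {σ ^ k • y - y} := by
  obtain ⟨c, hc⟩ := Ideal.mem_span_singleton'.1
    (hy ▸ pow_smul_sub_mem_augmentationIdeal σ k y)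
  by_cases hu : IsUnit c
  · rw [← hc, hy, Ideal.span_singleton_mul_left_unit hu]
  · have hmem : ∀ n : ℕ, (σ ^ k) ^ n • y - y ∈
        IsLocalRing.maximalIdeal B * augmentationIdeal B σ := by
      intro n
      induction n with
      | zero => simp
      | succ n ih =>
        have h : (σ ^ k) ^ (n + 1) • y - y =
            (σ ^ k) ^ n • (σ ^ k • y - y) + ((σ ^ k) ^ n • y - y) := by
          rw [pow_succ, mul_smul, smul_sub]; ring
        rw [h]
        refine add_mem ?_ ih
        rw [← hc, smul_mul', ← pow_mul]
        exact Ideal.mul_mem_mul (smul_mem_maximalIdeal _ hu)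
          (pow_smul_mem_augmentationIdeal σ _ (smul_sub_mem_augmentationIdeal σ y))
    -- A non-unit `c` would put `σ y - y` in `𝔪 I`, which forces `I = 0`; the claim then holds
    -- trivially.
    have h1 := hmem l
    rw [hkl, hy] at h1
    obtain ⟨z, hz, hzx⟩ := Ideal.mem_mul_span_singleton.1 h1
    have hx0 : σ • y - y = 0 := by
      by_contra hx0
      have : z = 1 := mul_right_cancel₀ hx0 (by rw [hzx, one_mul])
      exact (IsLocalRing.mem_maximalIdeal z).1 hz (this ▸ isUnit_one)
    rw [← hc, hy, hx0, mul_zero]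

/-- Newton interpolation along the orbit of `y`: the divided differences stay in `B` because
`σ ^ k y - y` generates the augmentation ideal. -/
theorem exists_interpolation [IsDomain B] {σ : G} {y : B} {p : ℕ}
    (hy : ∀ k, 0 < k → k < p → augmentationIdeal B σ = Ideal.span {σ ^ k • y - y})
    (hy0 : ∀ k, 0 < k → k < p → σ ^ k • y - y ≠ 0) (b : B) (k : ℕ) (hk : k ≤ p) :
    ∃ P : B[X], P.degree < k ∧ ∀ i < k, P.eval (σ ^ i • y) = σ ^ i • b := by
  induction k with
  | zero => exact ⟨0, by simp, by simp⟩
  | succ k ih =>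
    rcases Nat.eq_zero_or_pos k with rfl | hkpos
    · refine ⟨C b, ?_, ?_⟩
      · exact degree_C_lt
      · intro i hi
        obtain rfl : i = 0 := by omega
        simp
    obtain ⟨P, hdeg, hP⟩ := ih (by omega)
    -- `σ • P` interpolates on the shifted nodes `σ y, …, σ ^ k y`. The new polynomial is the
    -- Aitken–Neville combination of `P` and `σ • P`; its denominator divides because the
    -- coefficients of `σ • P - P` lie in `I`.
    have hdvd : C (σ ^ k • y - y) ∣ σ • P - P := by
      rw [C_dvd_iff_dvd_coeff]
      intro n
      rw [coeff_sub, coeff_smul, ← Ideal.mem_span_singleton, ← hy k hkpos (by omega)]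
      exact smul_sub_mem_augmentationIdeal σ _
    obtain ⟨Q, hQ⟩ := hdvd
    have hz := hy0 k hkpos (by omega)
    have hQdeg : Q.degree < k := by
      have h1 : (σ • P - P).degree < k :=
        (degree_sub_le _ _).trans_lt (max_lt ((degree_smul_le _ _).trans_lt hdeg) hdeg)
      rwa [hQ, degree_C_mul hz] at h1
    refine ⟨P + (X - C y) * Q, ?_, ?_⟩
    · rw [Nat.cast_succ]
      refine (degree_add_le _ _).trans_lt (max_lt (hdeg.trans ?_) ?_)
      · exact_mod_cast Nat.lt_succ_self k
      · rw [degree_mul, degree_X_sub_C, add_comm]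
        exact WithBot.add_lt_add_right (by simp) hQdeg
    · have hσ : ∀ i, (σ • P).eval (σ ^ (i + 1) • y) = σ • P.eval (σ ^ i • y) := by
        intro i
        rw [pow_succ', mul_smul, smul_eval_smul]
      intro i hi
      have hev := congrArg (eval (σ ^ i • y)) hQ
      rw [eval_sub, eval_mul, eval_C] at hev
      rw [eval_add, eval_mul, eval_sub, eval_X, eval_C]
      rcases Nat.eq_zero_or_pos i with rfl | hi0
      · simpa using hP 0 hkpos
      obtain ⟨j, rfl⟩ : ∃ j, i = j + 1 := ⟨i - 1, by omega⟩
      rw [hσ, hP j (by omega), ← mul_smul, ← pow_succ'] at hev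
      rcases eq_or_lt_of_le (Nat.lt_succ_iff.1 hi) with h | h
      · rw [← h] at hev hz
        linear_combination -hev
      · rw [hP _ h, sub_self] at hev
        rw [hP _ h, (mul_eq_zero.1 hev.symm).resolve_left hz]
        simp

theorem exists_polynomial_invariantRing {Q : B[X]} (hQ : ∀ g : G, g • Q = Q) :
    ∃ P : (InvariantRing G B)[X], P.map (algebraMap (InvariantRing G B) B) = Q ∧
      P.degree = Q.degree := by
  have h : Q ∈ lifts (algebraMap (InvariantRing G B) B) := by
    rw [lifts_iff_coeff_lifts]
    intro n
    refine ⟨⟨Q.coeff n, fun g => ?_⟩, rfl⟩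
    rw [← coeff_smul, hQ]
  exact exists_degree_eq_of_mem_lifts h

theorem exists_augmentationIdeal_eq_span [IsDomain B] [IsLocalRing B] {σ : G}
    (h : (augmentationIdeal B σ).IsPrincipal) :
    ∃ y : B, augmentationIdeal B σ = Ideal.span {σ • y - y} := by
  obtain ⟨_, ⟨y, rfl⟩, hy⟩ :=
    Ideal.exists_span_singleton_eq_of_isPrincipal (Set.range_nonempty _) h
  exact ⟨y, hy⟩

/-- For `b = P(y)` with invariant coefficients, `σ b - b = P(σ y) - P(y)` is divisible by `σ y - y`.
-/
theorem augmentationIdeal_eq_span_of_adjoin_eq_top {σ : G} {y : B}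
    (hy : Algebra.adjoin (InvariantRing G B) {y} = ⊤) :
    augmentationIdeal B σ = Ideal.span {σ • y - y} := by
  refine le_antisymm (Ideal.span_le.2 ?_)
    ((Ideal.span_singleton_le_iff_mem _).2 (smul_sub_mem_augmentationIdeal σ y))
  rintro _ ⟨b, rfl⟩
  have hb : b ∈ Algebra.adjoin (InvariantRing G B) {y} := hy ▸ Algebra.mem_top
  rw [Algebra.adjoin_singleton_eq_range_aeval] at hb
  obtain ⟨P, rfl⟩ := hb
  have hfix : σ • P.map (algebraMap (InvariantRing G B) B) =
      P.map (algebraMap (InvariantRing G B) B) := by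
    ext n
    rw [coeff_smul, coeff_map]
    exact (P.coeff n).2 σ
  have h : σ • (aeval y P : B) = (P.map (algebraMap (InvariantRing G B) B)).eval (σ • y) := by
    rw [← hfix, smul_eval_smul, eval_map, ← aeval_def]
  rw [SetLike.mem_coe, Ideal.mem_span_singleton, augmentationMap]
  change _ ∣ σ • (aeval y P : B) - aeval y P
  rw [h, aeval_def, ← eval_map]
  exact sub_dvd_eval_sub _ _ _

section CyclicOfPrimeOrder

variable {p : ℕ} {σ : G}

theorem smul_polynomial_eq_of_zpowers_eq_top (hσ : Subgroup.zpowers σ = ⊤) {P : B[X]}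
    (h : σ • P = P) (g : G) : g • P = P := by
  have hle : Subgroup.zpowers σ ≤ MulAction.stabilizer G P := by
    rw [Subgroup.zpowers_le]
    exact h
  exact hle (hσ ▸ Subgroup.mem_top g)

theorem orderOf_eq_of_zpowers_eq_top (hG : Nat.card G = p) (hσ : Subgroup.zpowers σ = ⊤) :
    orderOf σ = p := by
  rw [← hG, ← Nat.card_zpowers, hσ, Subgroup.card_top]

theorem exists_pow_pow_eq_self (hp : p.Prime) (hσ : orderOf σ = p) {k : ℕ} (h0 : 0 < k)
    (hk : k < p) : ∃ l : ℕ, (σ ^ k) ^ l = σ := by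
  have hco : (orderOf σ).Coprime k := by
    rw [hσ]
    exact (Nat.coprime_of_lt_prime h0.ne' hk hp)
  exact exists_pow_eq_self_of_coprime hco.symm

theorem augmentationIdeal_ne_bot [FaithfulSMul G B] (hσ : σ ≠ 1) :
    augmentationIdeal B σ ≠ ⊥ := by
  intro h
  refine hσ (FaithfulSMul.eq_of_smul_eq_smul (α := B) fun b => ?_)
  have := smul_sub_mem_augmentationIdeal σ b
  rw [h, Ideal.mem_bot, sub_eq_zero] at this
  rw [this, one_smul]

variable [IsDomain B] [IsLocalRing B] [FaithfulSMul G B]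

/-- A coincidence in the orbit gives `σ ^ k y = y` with `0 < k < p`; as `σ ^ k y - y` generates `I`,
this would make `I` zero, against faithfulness. -/
theorem pow_smul_injOn (hp : p.Prime) (hσ : orderOf σ = p) {y : B}
    (hy : augmentationIdeal B σ = Ideal.span {σ • y - y}) :
    Set.InjOn (fun i : ℕ => σ ^ i • y) (Finset.range p) := by
  have hne : ∀ k, 0 < k → k < p → σ ^ k • y - y ≠ 0 := by
    intro k h0 hk h
    obtain ⟨l, hl⟩ := exists_pow_pow_eq_self hp hσ h0 hk
    have hI := span_pow_smul_sub_eq_augmentationIdeal hy hl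
    rw [h, Ideal.span_singleton_eq_bot.2 rfl] at hI
    refine augmentationIdeal_ne_bot ?_ hI
    rintro rfl
    rw [orderOf_one] at hσ
    exact hp.one_lt.ne hσ
  have key : ∀ i j, i < j → j < p → σ ^ i • y ≠ σ ^ j • y := by
    intro i j hij hj h
    refine hne (j - i) (by omega) (by omega) ?_
    have hji : j = i + (j - i) := by omega
    rw [hji, pow_add, mul_smul] at h
    rw [sub_eq_zero]
    exact (MulAction.injective (σ ^ i) h).symm
  intro i hi j hj h
  simp only [Finset.coe_range, Set.mem_Iio] at hi hj
  rcases lt_trichotomy i j with h' | h' | h'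
  · exact absurd h (key i j h' hj)
  · exact h'
  · exact absurd h.symm (key j i h' hi)

/-- The interpolant of the orbit of `b` along the orbit of `y` is unique, hence fixed by `σ`, so its
coefficients are invariants. -/
theorem exists_aeval_eq_of_augmentationIdeal_eq_span (hp : p.Prime) (hσp : orderOf σ = p)
    (hσ : Subgroup.zpowers σ = ⊤) {y : B}
    (hy : augmentationIdeal B σ = Ideal.span {σ • y - y}) (b : B) :
    ∃ P : (InvariantRing G B)[X], P.degree < p ∧ aeval y P = b := by
  have hinj := pow_smul_injOn hp hσp hy
  obtain ⟨P, hdeg, hP⟩ := exists_interpolation (p := p) (σ := σ) (y := y)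
    (fun k h0 hk => by
      obtain ⟨l, hl⟩ := exists_pow_pow_eq_self hp hσp h0 hk
      exact span_pow_smul_sub_eq_augmentationIdeal hy hl)
    (fun k h0 hk h => by
      have := @hinj k (by simpa using hk) 0 (by simpa using hp.pos)
        (by simpa using sub_eq_zero.1 h)
      omega) b p le_rfl
  have hPσ : σ • P = P := by
    refine eq_of_degree_sub_lt_of_eval_index_eq (Finset.range p) hinj ?_ ?_
    · rw [Finset.card_range]
      exact (degree_sub_le _ _).trans_lt (max_lt ((degree_smul_le _ _).trans_lt hdeg) hdeg)
    · intro i hi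
      rw [Finset.mem_range] at hi
      rw [hP i hi]
      -- The node `y` is reached from the last one, since `σ ^ p = 1`.
      rcases Nat.eq_zero_or_pos i with rfl | hi0
      · have hpow : ∀ x : B, σ ^ 0 • x = σ • σ ^ (p - 1) • x := by
          intro x
          rw [← mul_smul, ← pow_succ', Nat.sub_add_cancel hp.one_le, ← hσp, pow_orderOf_eq_one,
            pow_zero]
        rw [hpow, hpow, smul_eval_smul, hP (p - 1) (by have := hp.pos; omega)]
      · obtain ⟨j, rfl⟩ : ∃ j, i = j + 1 := ⟨i - 1, by omega⟩
        rw [pow_succ', mul_smul, smul_eval_smul, hP j (by omega), mul_smul]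
  obtain ⟨Q, hQ, hQdeg⟩ :=
    exists_polynomial_invariantRing (smul_polynomial_eq_of_zpowers_eq_top hσ hPσ)
  refine ⟨Q, hQdeg ▸ hdeg, ?_⟩
  rw [aeval_def, ← eval_map, hQ]
  simpa using hP 0 hp.pos

/-- With invariant coefficients, a root `y` brings `p` distinct roots `σ ^ i y`, too many for the
degree. -/
theorem degreeLT_aeval_injective (hp : p.Prime) (hσp : orderOf σ = p) {y : B}
    (hy : augmentationIdeal B σ = Ideal.span {σ • y - y}) {P : (InvariantRing G B)[X]}
    (hdeg : P.degree < p) (hP : aeval y P = 0) : P = 0 := by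
  have hinj := pow_smul_injOn hp hσp hy
  have hmap : P.map (algebraMap (InvariantRing G B) B) = 0 := by
    refine eq_of_degree_sub_lt_of_eval_index_eq (Finset.range p) hinj ?_ ?_
    · rw [Finset.card_range, sub_zero]
      exact (degree_map_le).trans_lt hdeg
    · intro i _
      have hfix : σ ^ i • P.map (algebraMap (InvariantRing G B) B) =
          P.map (algebraMap (InvariantRing G B) B) := by
        ext n
        rw [coeff_smul, coeff_map]
        exact (P.coeff n).2 (σ ^ i)
      rw [← hfix, smul_eval_smul, eval_map, ← aeval_def, hP, smul_zero, eval_zero]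
  exact (Polynomial.map_eq_zero_iff Subtype.val_injective).1 hmap

theorem free_of_augmentationIdeal_eq_span (hp : p.Prime) (hσp : orderOf σ = p)
    (hσ : Subgroup.zpowers σ = ⊤) {y : B}
    (hy : augmentationIdeal B σ = Ideal.span {σ • y - y}) :
    Module.Free (InvariantRing G B) B := by
  let f : degreeLT (InvariantRing G B) p →ₗ[InvariantRing G B] B :=
    (aeval y).toLinearMap.comp (degreeLT (InvariantRing G B) p).subtype
  have hf : Function.Bijective f := by
    constructor
    · rw [injective_iff_map_eq_zero]
      rintro ⟨P, hP⟩ h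
      exact Subtype.ext (degreeLT_aeval_injective hp hσp hy (mem_degreeLT.1 hP) h)
    · intro b
      obtain ⟨P, hdeg, hP⟩ := exists_aeval_eq_of_augmentationIdeal_eq_span hp hσp hσ hy b
      exact ⟨⟨P, mem_degreeLT.2 hdeg⟩, hP⟩
  exact Module.Free.of_equiv
    ((degreeLTEquiv (InvariantRing G B) p).symm.trans (LinearEquiv.ofBijective f hf))

theorem adjoin_eq_top_of_augmentationIdeal_eq_span (hp : p.Prime) (hσp : orderOf σ = p)
    (hσ : Subgroup.zpowers σ = ⊤) {y : B}
    (hy : augmentationIdeal B σ = Ideal.span {σ • y - y}) :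
    Algebra.adjoin (InvariantRing G B) {y} = ⊤ := by
  refine eq_top_iff.2 fun b _ => ?_
  obtain ⟨P, -, rfl⟩ := exists_aeval_eq_of_augmentationIdeal_eq_span hp hσp hσ hy b
  exact aeval_mem_adjoin_singleton _ _

end CyclicOfPrimeOrder

end Monogenous

/-! ### Regular local rings: domains with regular systems of parameters -/

section RegularLocalRing

open IsLocalRing RingTheory.Sequence Pointwise

universe u

variable {R : Type u} [CommRing R]

/-- From a generating set of the maximal ideal one can complete an element `x ∉ 𝔪 ^ 2` to a minimal
system of generators. -/
theorem exists_minimal_generators_insert [IsLocalRing R] [IsNoetherianRing R] {S : Set R}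
    (hSm : S ⊆ maximalIdeal R) {x : R} (hx : x ∈ maximalIdeal R) (hx2 : x ∉ maximalIdeal R ^ 2)
    (hS : Ideal.span (insert x S) = maximalIdeal R) :
    ∃ (n : ℕ) (f : Fin n → R), (∀ i, f i ∈ S) ∧
      Ideal.span (insert x (Set.range f)) = maximalIdeal R ∧
      (maximalIdeal R).spanFinrank = n + 1 := by
  let v : maximalIdeal R → CotangentSpace R := (maximalIdeal R).toCotangent
  let x' : maximalIdeal R := ⟨x, hx⟩
  have hv : v x' ≠ 0 := fun h => hx2 ((maximalIdeal R).toCotangent_eq_zero _ |>.1 h)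
  have hspan : ∀ T : Set (maximalIdeal R), Submodule.span R T = ⊤ ↔
      Ideal.span ((↑) '' T) = maximalIdeal R := by
    intro T
    rw [← (Submodule.map_injective_of_injective (maximalIdeal R).injective_subtype).eq_iff,
      Submodule.map_span, Submodule.map_subtype_top]
    rfl
  -- Extend the nonzero class of `x` to a basis of the cotangent space taken from classes of `S`;
  -- Nakayama lifts it to generators.
  obtain ⟨b, hbt, hxb, hle, hli⟩ := exists_linearIndepOn_extension (K := ResidueField R)
    (LinearIndepOn.singleton (R := ResidueField R) hv)
    (Set.singleton_subset_iff.2 (Set.mem_insert x' ((↑) ⁻¹' S)))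
  have himg : ((↑) : maximalIdeal R → R) '' (insert x' ((↑) ⁻¹' S)) = insert x S := by
    rw [Set.image_insert_eq]
    congr 1
    rw [Set.image_preimage_eq_iff]
    intro s hs
    exact ⟨⟨s, hSm hs⟩, rfl⟩
  have htop : Submodule.span (ResidueField R) (v '' b) = ⊤ := by
    refine eq_top_iff.2 (le_trans (eq_top_iff.1 ?_) (Submodule.span_le.2 hle))
    rw [CotangentSpace.span_image_eq_top_iff, hspan, himg, hS]
  have hbtop : Ideal.span ((↑) '' b) = maximalIdeal R := by
    rw [← hspan, ← CotangentSpace.span_image_eq_top_iff]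
    exact htop
  let B := Module.Basis.mk hli (by rw [← Set.image_eq_range, htop])
  have hfin : Finite b := Module.Finite.finite_basis B
  have hcard : (maximalIdeal R).spanFinrank = b.ncard := by
    rw [spanFinrank_maximalIdeal_eq_finrank_cotangentSpace, Module.finrank_eq_nat_card_basis B]
    rfl
  have hxb' : x' ∈ b := hxb rfl
  have hb : b.Finite := hfin
  have hfin' : (b \ {x'}).Finite := hb.subset Set.sdiff_subset
  let e : Fin (b \ {x'}).ncard ≃ ↥(b \ {x'}) := by
    have := hfin'.to_subtype
    exact (Finite.equivFin _).symm
  refine ⟨(b \ {x'}).ncard, fun i => ((e i : maximalIdeal R) : R), ?_, ?_, ?_⟩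
  · intro i
    exact (hbt (e i).2.1).resolve_left (e i).2.2
  · have hr : Set.range (fun i => ((e i : maximalIdeal R) : R)) = (↑) '' (b \ {x'}) := by
      rw [Set.image_eq_range]
      exact e.surjective.range_comp (fun z : ↥(b \ {x'}) => ((z : maximalIdeal R) : R))
    have hins : insert (x' : R) ((↑) '' (b \ {x'})) = (↑) '' b := by
      rw [← Set.image_insert_eq, Set.insert_sdiff_singleton, Set.insert_eq_of_mem hxb']
    rw [hr]
    exact (congrArg Ideal.span hins).trans hbtop
  · rw [hcard, Set.ncard_sdiff_singleton_add_one hxb' hb]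

/-- Killing `x` lowers the number of generators of the maximal ideal by one, and the dimension by at
most one. -/
theorem isRegularLocalRing_quotient_span_singleton [IsRegularLocalRing R] {x : R}
    (hx : x ∈ maximalIdeal R) (hx2 : x ∉ maximalIdeal R ^ 2) :
    IsRegularLocalRing (R ⧸ Ideal.span {x}) ∧
      ringKrullDim (R ⧸ Ideal.span {x}) + 1 = ringKrullDim R := by
  have hle : Ideal.span {x} ≤ maximalIdeal R := (Ideal.span_singleton_le_iff_mem _).2 hx
  have : Nontrivial (R ⧸ Ideal.span {x}) := Ideal.Quotient.nontrivial_iff.2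
    (ne_top_of_le_ne_top (maximalIdeal.isMaximal R).ne_top hle)
  have hloc : IsLocalRing (R ⧸ Ideal.span {x}) :=
    .of_surjective' (Ideal.Quotient.mk _) Ideal.Quotient.mk_surjective
  obtain ⟨n, f, -, hf, hn⟩ := exists_minimal_generators_insert subset_rfl hx hx2
    (by rw [Set.insert_eq_of_mem (by exact hx)]; exact (maximalIdeal R).span_eq)
  have hdim : ringKrullDim R = ((n + 1 : ℕ) : WithBot ℕ∞) := by
    rw [← hn, IsRegularLocalRing.spanFinrank_maximalIdeal]
  have hmax : maximalIdeal (R ⧸ Ideal.span {x}) =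
      Ideal.span (Set.range (Ideal.Quotient.mk (Ideal.span {x}) ∘ f)) := by
    rw [← map_maximalIdeal_of_surjective (Ideal.Quotient.mk (Ideal.span {x}))
      Ideal.Quotient.mk_surjective, ← hf, Ideal.map_span, Set.image_insert_eq,
      Ideal.span_insert, ← Set.range_comp, sup_eq_right]
    have : Ideal.Quotient.mk (Ideal.span {x}) x = 0 :=
      Ideal.Quotient.eq_zero_iff_mem.2 (Ideal.mem_span_singleton_self x)
    rw [this, Ideal.span_singleton_eq_bot.2 rfl]
    exact bot_le
  have hgen : (maximalIdeal (R ⧸ Ideal.span {x})).spanFinrank ≤ n := by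
    rw [hmax]
    refine (Submodule.spanFinrank_span_le_ncard_of_finite (Set.finite_range _)).trans ?_
    rw [← Set.image_univ]
    exact (Set.ncard_image_le Set.finite_univ).trans (by simp [Set.ncard_univ])
  have hge : ((n : ℕ) : WithBot ℕ∞) ≤ ringKrullDim (R ⧸ Ideal.span {x}) := by
    have h := ringKrullDim_le_ringKrullDim_quotSMulTop_succ hx
    have hxt : x • (⊤ : Ideal R) = Ideal.span {x} := by
      rw [← Submodule.ideal_span_singleton_smul, smul_eq_mul, Ideal.mul_top]
    rw [hxt, hdim, Nat.cast_add, Nat.cast_one] at h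
    exact ENat.WithBot.add_le_add_one_right_iff.1 h
  have hreg : IsRegularLocalRing (R ⧸ Ideal.span {x}) :=
    .of_spanFinrank_maximalIdeal_le _ ((Nat.cast_le.2 hgen).trans hge)
  refine ⟨hreg, ?_⟩
  have := IsRegularLocalRing.spanFinrank_maximalIdeal (R := R ⧸ Ideal.span {x})
  rw [hdim, Nat.cast_add, Nat.cast_one]
  congr 1
  exact le_antisymm (this ▸ Nat.cast_le.2 hgen) hge

theorem maximalIdeal_eq_bot_of_le_sq [IsLocalRing R] [IsNoetherianRing R]
    (h : maximalIdeal R ≤ maximalIdeal R ^ 2) : maximalIdeal R = ⊥ := by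
  refine Submodule.eq_bot_of_le_smul_of_le_jacobson_bot (maximalIdeal R) _
    (maximalIdeal R).fg_of_isNoetherianRing ?_ (maximalIdeal_le_jacobson _)
  rwa [smul_eq_mul, ← pow_two]

/-- Choose `x ∈ 𝔪` outside `𝔪 ^ 2` and all minimal primes. By induction `(x)` is prime; a minimal
prime `P ⊆ (x)` omits `x`, so `P = xP` and `P = 0` by Nakayama. -/
theorem IsRegularLocalRing.isDomain_of_dim (d : ℕ) : ∀ (R : Type u) [CommRing R]
    [IsRegularLocalRing R], ringKrullDim R = d → IsDomain R := by
  induction d with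
  | zero =>
    intro R _ _ hd
    have h := IsRegularLocalRing.spanFinrank_maximalIdeal (R := R)
    rw [hd, Nat.cast_inj, Submodule.spanFinrank_eq_zero_iff_eq_bot
      (maximalIdeal R).fg_of_isNoetherianRing] at h
    exact (isField_iff_maximalIdeal_eq.2 h).isDomain
  | succ d ih =>
    intro R _ _ hd
    obtain ⟨x, hx, hxn⟩ : ∃ x ∈ maximalIdeal R,
        x ∉ ⋃ I ∈ insert (maximalIdeal R ^ 2) (minimalPrimes R), (I : Set R) := by
      by_contra! hcon
      -- Prime avoidance tolerates two non-prime members; `𝔪 ^ 2` fills both slots.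
      obtain ⟨I, hI, hle⟩ := (Ideal.subset_union_prime_finite
        ((minimalPrimes.finite_of_isNoetherianRing R).insert (maximalIdeal R ^ 2)) (f := id)
        (maximalIdeal R ^ 2) (maximalIdeal R ^ 2) (fun I hI h _ =>
          Ideal.IsMinimalPrime.isPrime (hI.resolve_left h))).1 hcon
      rcases hI with rfl | hI
      · have h0 := maximalIdeal_eq_bot_of_le_sq hle
        have h := IsRegularLocalRing.spanFinrank_maximalIdeal (R := R)
        rw [h0, Submodule.spanFinrank_bot, hd, Nat.cast_inj] at h
        omega
      · have hprime := Ideal.IsMinimalPrime.isPrime hI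
        have hI' : I = maximalIdeal R := le_antisymm (le_maximalIdeal hprime.ne_top) hle
        have h := maximalIdeal_height_eq_ringKrullDim (R := R)
        have h0 : (maximalIdeal R).height = 0 := by
          rw [Ideal.height_eq_zero_iff, ← hI']
          exact hI
        rw [h0, hd] at h
        have : ((0 : ℕ) : WithBot ℕ∞) = ((d + 1 : ℕ) : WithBot ℕ∞) := h
        rw [Nat.cast_inj] at this
        omega
    simp only [Set.mem_iUnion, not_exists] at hxn
    have hx2 : x ∉ maximalIdeal R ^ 2 := hxn _ (Set.mem_insert _ _)
    obtain ⟨hreg, hdim⟩ := isRegularLocalRing_quotient_span_singleton hx hx2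
    have hdom := ih (R ⧸ Ideal.span {x})
      (ENat.WithBot.add_natCast_cancel.1 (by rw [hd] at hdim; exact_mod_cast hdim))
    have hprime : (Ideal.span {x}).IsPrime := (Ideal.Quotient.isDomain_iff_prime _).1 hdom
    obtain ⟨P, hP, hPle⟩ := Ideal.exists_minimalPrimes_le (bot_le : ⊥ ≤ Ideal.span {x})
    have hPprime := Ideal.IsMinimalPrime.isPrime hP
    have hxP : x ∉ P := hxn P (Set.mem_insert_of_mem _ hP)
    have hPbot : P = ⊥ := by
      refine Submodule.eq_bot_of_le_smul_of_le_jacobson_bot (Ideal.span {x}) P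
        P.fg_of_isNoetherianRing ?_ (((Ideal.span_singleton_le_iff_mem _).2 hx).trans
          (maximalIdeal_le_jacobson _))
      intro z hz
      obtain ⟨c, rfl⟩ := Ideal.mem_span_singleton'.1 (hPle hz)
      rw [mul_comm]
      exact Ideal.mul_mem_mul (Ideal.mem_span_singleton_self x)
        ((hPprime.mem_or_mem hz).resolve_right hxP)
    have : (⊥ : Ideal R).IsPrime := hPbot ▸ hPprime
    exact IsDomain.of_bot_isPrime R

/-- The maximal ideal of a regular local ring of dimension `d` is generated by a weakly regular
sequence of length `d`. -/
theorem IsRegularLocalRing.exists_isWeaklyRegular (d : ℕ) : ∀ (R : Type u) [CommRing R]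
    [IsRegularLocalRing R], ringKrullDim R = d →
    ∃ rs : List R, rs.length = d ∧ Ideal.ofList rs = maximalIdeal R ∧ IsWeaklyRegular R rs := by
  induction d with
  | zero =>
    intro R _ _ hd
    have h := IsRegularLocalRing.spanFinrank_maximalIdeal (R := R)
    rw [hd, Nat.cast_inj, Submodule.spanFinrank_eq_zero_iff_eq_bot
      (maximalIdeal R).fg_of_isNoetherianRing] at h
    exact ⟨[], rfl, by rw [h, Ideal.ofList_nil], IsWeaklyRegular.nil R R⟩
  | succ d ih =>
    intro R _ _ hd
    have := IsRegularLocalRing.isDomain_of_dim (d + 1) R hd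
    obtain ⟨x, hx, hx2⟩ : ∃ x ∈ maximalIdeal R, x ∉ maximalIdeal R ^ 2 := by
      by_contra! hcon
      have h0 := maximalIdeal_eq_bot_of_le_sq hcon
      have h := IsRegularLocalRing.spanFinrank_maximalIdeal (R := R)
      rw [h0, Submodule.spanFinrank_bot, hd, Nat.cast_inj] at h
      omega
    obtain ⟨hreg, hdim⟩ := isRegularLocalRing_quotient_span_singleton hx hx2
    obtain ⟨rs, hlen, hmax, hrs⟩ := ih (R ⧸ Ideal.span {x})
      (ENat.WithBot.add_natCast_cancel.1 (by rw [hd] at hdim; exact_mod_cast hdim))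
    obtain ⟨rs, rfl⟩ := List.map_surjective_iff.2
      (Ideal.Quotient.mk_surjective (I := Ideal.span {x})) rs
    refine ⟨x :: rs, by simpa using hlen, ?_, ?_⟩
    · rw [← Ideal.map_ofList, ← map_maximalIdeal_of_surjective
        (Ideal.Quotient.mk (Ideal.span {x})) Ideal.Quotient.mk_surjective] at hmax
      have h := congrArg (Ideal.comap (Ideal.Quotient.mk (Ideal.span {x}))) hmax
      rw [Ideal.comap_map_of_surjective _ Ideal.Quotient.mk_surjective,
        Ideal.comap_map_of_surjective _ Ideal.Quotient.mk_surjective,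
        ← RingHom.ker_eq_comap_bot, Ideal.mk_ker,
        sup_eq_left.2 ((Ideal.span_singleton_le_iff_mem _).2 hx)] at h
      rw [Ideal.ofList_cons, sup_comm, h]
    · rw [isWeaklyRegular_cons_iff']
      refine ⟨?_, ?_⟩
      · refine (isSMulRegular_iff_right_eq_zero_of_smul (M := R)).2 fun z hz => ?_
        refine (mul_eq_zero.1 hz).resolve_left ?_
        rintro rfl
        exact hx2 (zero_mem _)
      · have hxt : x • (⊤ : Ideal R) = Ideal.span {x} := by
          rw [← Submodule.ideal_span_singleton_smul, smul_eq_mul, Ideal.mul_top]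
        let e : QuotSMulTop x R ≃ₗ[R] (R ⧸ Ideal.span {x}) :=
          Submodule.quotEquivOfEq (x • (⊤ : Ideal R)) (Ideal.span {x}) hxt
        exact ((e.extendScalarsOfSurjective
          Ideal.Quotient.mk_surjective).isWeaklyRegular_congr _).2 hrs

end RegularLocalRing

/-! ### The Koszul complex as an iterated mapping cone -/

section Koszul

universe u

/-- The Koszul complex on `f 0, …, f (n - 1)`, with its grading forgotten, together with the chain
`e i` of elementary wedges on the first `i` basis vectors. -/
theorem exists_koszul {R : Type u} [CommRing R] (f : ℕ → R) (n : ℕ) :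
    ∃ (K : Type u) (_ : AddCommGroup K) (_ : Module R K) (d : K →ₗ[R] K) (e : ℕ → K)
      (ε : K →ₗ[R] R), Module.Free R K ∧ (∀ x, d (d x) = 0) ∧
      (∀ x, d x ∈ Ideal.span (f '' Set.Iio n) • (⊤ : Submodule R K)) ∧ ε (e 0) = 1 ∧
      ∀ i < n, ∃ w ∈ Ideal.span (f '' Set.Iio i) • (⊤ : Submodule R K),
        d (e (i + 1)) = f i • e i + w := by
  induction n with
  | zero =>
    exact ⟨R, inferInstance, inferInstance, 0, fun _ => 1, LinearMap.id, inferInstance,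
      fun _ => rfl, fun _ => zero_mem _, rfl, fun i hi => absurd hi (Nat.not_lt_zero i)⟩
  | succ n ih =>
    obtain ⟨K, _, _, d, e, ε, hfree, hdd, hd, hε, he⟩ := ih
    have hmono : Ideal.span (f '' Set.Iio n) ≤ Ideal.span (f '' Set.Iio (n + 1)) :=
      Ideal.span_mono (Set.image_mono (Set.Iio_subset_Iio (Nat.le_succ n)))
    have hmap : ∀ (J : Ideal R) (g : K →ₗ[R] K × K), ∀ x ∈ J • (⊤ : Submodule R K),
        g x ∈ J • (⊤ : Submodule R (K × K)) := fun J g x hx =>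
      Submodule.smul_top_le_comap_smul_top J g hx
    -- Mapping cone of multiplication by `f n`: the pair `(a, b)` stands for `a + u ∧ b`, where `u`
    -- is the new basis vector.
    let d' : K × K →ₗ[R] K × K :=
      LinearMap.prod (d.comp (LinearMap.fst R K K) + f n • LinearMap.snd R K K)
        (-d.comp (LinearMap.snd R K K))
    have hd' : ∀ a b, d' (a, b) = (d a + f n • b, -d b) := fun _ _ => rfl
    refine ⟨K × K, inferInstance, inferInstance, d',
      fun i => if i ≤ n then (e i, 0) else (0, e n), ε.comp (LinearMap.fst R K K), inferInstance,
      ?_, ?_, ?_, ?_⟩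
    · rintro ⟨a, b⟩
      simp [hd', hdd]
    · rintro ⟨a, b⟩
      have h : d' (a, b) = LinearMap.inl R K K (d a) + f n • (b, (0 : K)) +
          LinearMap.inr R K K (-d b) := by
        simp [hd']
      rw [h]
      refine add_mem (add_mem ?_ ?_) ?_
      · exact Submodule.smul_mono_left hmono (hmap _ _ _ (hd a))
      · exact Submodule.smul_mem_smul (Ideal.subset_span ⟨n, Nat.lt_succ_self n, rfl⟩) trivial
      · exact Submodule.smul_mono_left hmono (hmap _ _ _ (neg_mem (hd b)))
    · simpa using hε
    · intro i hi
      rcases eq_or_lt_of_le (Nat.lt_succ_iff.1 hi) with rfl | h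
      · refine ⟨LinearMap.inr R K K (-d (e i)), hmap _ _ _ (neg_mem (hd _)), ?_⟩
        simp [hd']
      · obtain ⟨w, hw, hwe⟩ := he i h
        refine ⟨LinearMap.inl R K K w, hmap _ _ _ hw, ?_⟩
        have h1 : i + 1 ≤ n := h
        simp [hd', hwe, h1, h.le]

end Koszul

/-! ### Minimal covers over a local ring -/

section Syzygies

open IsLocalRing

universe u v

variable {A : Type u} [CommRing A] [IsLocalRing A]

/-- A finite module over a local ring has a finite free cover with kernel in `𝔪 F`. -/
theorem exists_minimal_cover (M : Type v) [AddCommGroup M] [Module A M]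
    [Module.Finite A M] : ∃ (n : ℕ) (d : (Fin n → A) →ₗ[A] M), Function.Surjective d ∧
      LinearMap.ker d ≤ maximalIdeal A • ⊤ := by
  let b := Module.finBasis (ResidueField A) (TensorProduct A (ResidueField A) M)
  obtain ⟨v, hv⟩ := (TensorProduct.mk_surjective A M (ResidueField A)
    Ideal.Quotient.mk_surjective).comp_left b
  have hv' : ∀ i, (1 : ResidueField A) ⊗ₜ[A] v i = b i := fun i => congrFun hv i
  have hspan := span_eq_top_of_tmul_eq_basis v b hv'
  refine ⟨_, Fintype.linearCombination A v, ?_, ?_⟩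
  · rw [← LinearMap.range_eq_top, Fintype.range_linearCombination, hspan]
  · intro a ha
    have h : ∑ i, residue A (a i) • b i = 0 := by
      have h1 := congrArg (TensorProduct.mk A (ResidueField A) M 1) (LinearMap.mem_ker.1 ha)
      rw [Fintype.linearCombination_apply, map_sum, map_zero] at h1
      rw [← h1]
      refine Finset.sum_congr rfl fun i _ => ?_
      rw [map_smul, TensorProduct.mk_apply, hv']
      rfl
    have hai : ∀ i, a i ∈ maximalIdeal A := fun i =>
      (residue_eq_zero_iff _).1 (Fintype.linearIndependent_iff.1 b.linearIndependent _ h i)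
    rw [pi_eq_sum_univ' a]
    exact sum_mem fun i _ => Submodule.smul_mem_smul (hai i) trivial

/-- A vector outside `𝔪 F` has a unit coordinate, on which membership can be tested. -/
theorem mem_of_smul_mem_smul_top {F : Type v} [AddCommGroup F] [Module A F] [Module.Free A F]
    [Module.Finite A F] {J : Ideal A} {x : A} {z : F} (hz : z ∉ maximalIdeal A • (⊤ : Submodule A F))
    (h : x • z ∈ J • (⊤ : Submodule A F)) : x ∈ J := by
  let b := Module.finBasis A F
  obtain ⟨i, hi⟩ : ∃ i, IsUnit (b.repr z i) := by
    by_contra! hcon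
    refine hz ?_
    rw [← b.sum_repr z]
    exact sum_mem fun i _ => Submodule.smul_mem_smul (hcon i) trivial
  have h1 := Submodule.smul_top_le_comap_smul_top J (b.coord i) h
  rw [Submodule.mem_comap, map_smul, smul_eq_mul, smul_eq_mul, Ideal.mul_top] at h1
  exact (Ideal.mul_unit_mem_iff_mem J hi).1 h1

end Syzygies

/-! ### Regular sequences along short exact sequences -/

section WeaklyRegular

open IsLocalRing RingTheory.Sequence Pointwise

open Function

variable {R M M' M'' : Type*} [CommRing R] [AddCommGroup M] [Module R M] [AddCommGroup M']
  [Module R M'] [AddCommGroup M''] [Module R M'']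

/-- The obstruction comes from the `r`-torsion of `M''`, which vanishes. -/
theorem QuotSMulTop.map_injective_of_isSMulRegular {r : R} {f : M →ₗ[R] M'} {g : M' →ₗ[R] M''}
    (hf : Injective f) (hfg : Exact f g) (hr : IsSMulRegular M'' r) :
    Injective (QuotSMulTop.map r f) := by
  have h0 : Exact (0 : M →ₗ[R] M) f := by
    intro x
    rw [← map_zero f, hf.eq_iff]
    exact ⟨fun h => ⟨0, h.symm⟩, fun ⟨_, h⟩ => h.symm⟩
  have h := map_first_exact_on_four_term_exact_of_isSMulRegular_last h0 hfg hr
  rw [injective_iff_map_eq_zero]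
  intro x hx
  obtain ⟨y, rfl⟩ := (h x).1 hx
  simp

/-- Depth increases by one on passing to a syzygy. -/
theorem RingTheory.Sequence.IsWeaklyRegular.of_exact {rs : List R} {r : R} {f : M →ₗ[R] M'}
    {g : M' →ₗ[R] M''} (hf : Injective f) (hfg : Exact f g) (hg : Surjective g)
    (h' : IsWeaklyRegular M' (rs ++ [r])) (h'' : IsWeaklyRegular M'' rs) :
    IsWeaklyRegular M (rs ++ [r]) := by
  induction h'' generalizing M M' with
  | nil =>
    rw [List.nil_append, isWeaklyRegular_singleton_iff] at h' ⊢
    exact h'.of_injective f hf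
  | cons s rs hs _ ih =>
    rw [List.cons_append, isWeaklyRegular_cons_iff] at h' ⊢
    exact ⟨h'.1.of_injective f hf, ih (QuotSMulTop.map_injective_of_isSMulRegular hf hfg hs)
      (QuotSMulTop.map_exact s hfg hg) (QuotSMulTop.map_surjective s hg) h'.2⟩

/-- Reduction modulo a sequence weakly regular on the cokernel keeps `f` injective. -/
theorem RingTheory.Sequence.IsWeaklyRegular.mem_ofList_smul_top {rs : List R} {f : M →ₗ[R] M'}
    {g : M' →ₗ[R] M''} (hf : Injective f) (hfg : Exact f g) (hg : Surjective g)
    (h'' : IsWeaklyRegular M'' rs) {x : M} (hx : f x ∈ Ideal.ofList rs • (⊤ : Submodule R M')) :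
    x ∈ Ideal.ofList rs • (⊤ : Submodule R M) := by
  have h0 : Exact (0 : M →ₗ[R] M) f := by
    intro x
    rw [← map_zero f, hf.eq_iff]
    exact ⟨fun h => ⟨0, h.symm⟩, fun ⟨_, h⟩ => h.symm⟩
  have h := map_first_exact_on_four_term_right_exact_of_isSMulRegular_last h0 hfg hg h''
  obtain ⟨y, hy⟩ := (h (Submodule.Quotient.mk x)).1 (by
    rw [Submodule.mapQ_apply, Submodule.Quotient.mk_eq_zero]
    exact hx)
  obtain ⟨y, rfl⟩ := Submodule.Quotient.mk_surjective _ y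
  rw [Submodule.mapQ_apply, LinearMap.zero_apply, Submodule.Quotient.mk_zero] at hy
  exact (Submodule.Quotient.mk_eq_zero _).1 hy.symm

end WeaklyRegular

/-! ### Descent of regularity -/

section FlatDescent

open IsLocalRing RingTheory.Sequence Pointwise

universe u v

/-- A minimal system of generators of the maximal ideal, as a sequence. -/
theorem exists_sequence_minimal_generators (A : Type u) [CommRing A] [IsLocalRing A]
    [IsNoetherianRing A] : ∃ f : ℕ → A, (∀ i, f i ∈ maximalIdeal A) ∧
      ∀ i < (maximalIdeal A).spanFinrank,
        f i ∉ maximalIdeal A ^ 2 ⊔ Ideal.span (f '' Set.Iio i) := by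
  have hfg := (maximalIdeal A).fg_of_isNoetherianRing
  obtain ⟨s, hs, hspan⟩ := Submodule.FG.exists_span_finset_card_eq_spanFinrank hfg
  let n := (maximalIdeal A).spanFinrank
  let e : Fin n ≃ s := (s.equivFinOfCardEq hs).symm
  let f : ℕ → A := fun i => if h : i < n then (e ⟨i, h⟩ : A) else 0
  have hsm : ∀ a ∈ s, a ∈ maximalIdeal A := fun a ha => hspan ▸ Submodule.subset_span ha
  refine ⟨f, fun i => ?_, fun i hi hmem => ?_⟩
  · by_cases h : i < n
    · simpa [f, h] using hsm _ (e ⟨i, h⟩).2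
    · simp [f, h]
  · classical
    have hfi : f i = (e ⟨i, hi⟩ : A) := dif_pos hi
    let t : Finset A := s.erase (f i)
    have hIio : Ideal.span (f '' Set.Iio i) ≤ Ideal.span (t : Set A) := by
      refine Ideal.span_mono ?_
      rintro _ ⟨j, hj, rfl⟩
      have hjn : j < n := lt_trans hj hi
      have hfj : f j = (e ⟨j, hjn⟩ : A) := dif_pos hjn
      refine Finset.mem_coe.2 (Finset.mem_erase.2 ⟨?_, hfj ▸ (e ⟨j, hjn⟩).2⟩)
      rw [hfj, hfi, Ne, Subtype.coe_inj, e.injective.eq_iff, Fin.mk.injEq]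
      exact (Set.mem_Iio.1 hj).ne
    -- Otherwise, by Nakayama, `f i` could be dropped from the generators, against minimality.
    have hle : maximalIdeal A ≤ Ideal.span (t : Set A) ⊔ maximalIdeal A • maximalIdeal A := by
      rw [smul_eq_mul, ← pow_two]
      refine hspan.ge.trans (Submodule.span_le.2 fun a ha => ?_)
      by_cases hai : a = f i
      · rw [hai, sup_comm]
        exact sup_le_sup_left hIio _ hmem
      · exact Ideal.mem_sup_left (Ideal.subset_span (Finset.mem_erase.2 ⟨hai, ha⟩))
    have hle' := Submodule.le_of_le_smul_of_le_jacobson_bot hfg (maximalIdeal_le_jacobson _) hle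
    have heq : Ideal.span (t : Set A) = maximalIdeal A :=
      le_antisymm (Ideal.span_le.2 fun a ha => hsm a (Finset.mem_of_mem_erase ha)) hle'
    have hcard := Submodule.spanFinrank_span_le_ncard_of_finite (R := A) (t.finite_toSet)
    change (Ideal.span (t : Set A)).spanFinrank ≤ _ at hcard
    have hmem' : f i ∈ s := hfi ▸ (e ⟨i, hi⟩).2
    rw [heq, Set.ncard_coe_finset, Finset.card_erase_of_mem hmem', hs] at hcard
    omega

theorem isNoetherianRing_of_faithfullyFlat (A : Type u) (B : Type v) [CommRing A] [CommRing B]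
    [Algebra A B] [Module.FaithfullyFlat A B] [IsNoetherianRing B] : IsNoetherianRing A := by
  rw [isNoetherianRing_iff, isNoetherian_iff]
  have hmono : StrictMono (Ideal.map (algebraMap A B)) :=
    Monotone.strictMono_of_injective (fun _ _ h => Ideal.map_mono h)
      Ideal.map_injective_of_faithfullyFlat
  exact hmono.wellFoundedGT.wf

theorem spanFinrank_maximalIdeal_le_length {A B : Type u} [CommRing A] [IsLocalRing A]
    [IsNoetherianRing A] [CommRing B] [IsLocalRing B] [Algebra A B] [Module.FaithfullyFlat A B]
    [IsLocalHom (algebraMap A B)] {rs : List B} (hrs : IsWeaklyRegular B rs)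
    (hmax : Ideal.ofList rs = maximalIdeal B) :
    (maximalIdeal A).spanFinrank ≤ rs.length := by
  obtain ⟨f, hfm, hf⟩ := exists_sequence_minimal_generators A
  set n := (maximalIdeal A).spanFinrank
  obtain ⟨K, _, _, d, e, ε, hfree, hdd, hd, hε, he⟩ := exists_koszul f n
  by_contra! hlt
  -- Stage `i` of the comparison: `F` is the `i`-th free module of a minimal resolution of the
  -- residue field, `F ⧸ M` the `i`-th syzygy, and `φ` the component of the comparison map that
  -- matters in degree `i`.
  let Good (i : ℕ) (F : Type u) [AddCommGroup F] [Module A F] (M : Submodule A F)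
    (φ : K →ₗ[A] F) : Prop :=
      Module.Free A F ∧ Module.Finite A F ∧ M ≤ maximalIdeal A • ⊤ ∧ (∀ x, φ (d x) ∈ M) ∧
      φ (e i) ∉ maximalIdeal A • (⊤ : Submodule A F) ∧
      IsWeaklyRegular (TensorProduct A B (F ⧸ M)) (rs.take i)
  -- Up to terms in the earlier `f j`, the boundary of `e (i + 1)` is `f i • e i`; minimality of the
  -- generators keeps its image out of `𝔪 ^ 2 F`.
  have hnot : ∀ (i : ℕ) (F : Type u) [AddCommGroup F] [Module A F] (M : Submodule A F)
      (φ : K →ₗ[A] F), Good i F M φ → i < n →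
      φ (d (e (i + 1))) ∉ maximalIdeal A ^ 2 • (⊤ : Submodule A F) := by
    rintro i F _ _ M φ ⟨_, _, hM, hφ, hφe, hreg⟩ hi hmem
    obtain ⟨w, hw, hwe⟩ := he i hi
    rw [hwe, map_add, map_smul] at hmem
    refine hf i hi (mem_of_smul_mem_smul_top hφe ?_)
    have h1 : φ w ∈ Ideal.span (f '' Set.Iio i) • (⊤ : Submodule A F) :=
      Submodule.smul_top_le_comap_smul_top _ φ hw
    rw [Submodule.sup_smul, ← add_sub_cancel_right (f i • φ (e i)) (φ w)]
    exact sub_mem (Submodule.mem_sup_left hmem) (Submodule.mem_sup_right h1)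
  have hexact : ∀ (F : Type u) [AddCommGroup F] [Module A F] (M : Submodule A F),
      Function.Injective (M.subtype.baseChange B) ∧
      Function.Exact (M.subtype.baseChange B) (M.mkQ.baseChange B) ∧
      Function.Surjective (M.mkQ.baseChange B) := by
    intro F _ _ M
    refine ⟨Module.Flat.lTensor_preserves_injective_linearMap M.subtype M.injective_subtype,
      lTensor_exact B (LinearMap.exact_subtype_mkQ M) M.mkQ_surjective,
      LinearMap.lTensor_surjective B M.mkQ_surjective⟩
  have hstep : ∀ i ≤ rs.length, ∃ (F : Type u) (_ : AddCommGroup F) (_ : Module A F)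
      (M : Submodule A F) (φ : K →ₗ[A] F), Good i F M φ := by
    intro i
    induction i with
    | zero =>
      intro _
      refine ⟨A, inferInstance, inferInstance, maximalIdeal A, ε, inferInstance, inferInstance,
        by simp, fun x => ?_, ?_, ?_⟩
      · have h := Submodule.smul_top_le_comap_smul_top _ ε (hd x)
        rw [Submodule.mem_comap, smul_eq_mul, Ideal.mul_top] at h
        refine (Ideal.span_le.2 ?_) h
        rintro _ ⟨j, _, rfl⟩
        exact hfm j
      · rw [hε, smul_eq_mul, Ideal.mul_top]
        exact (Ideal.ne_top_iff_one _).1 (maximalIdeal.isMaximal A).ne_top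
      · rw [List.take_zero]
        exact IsWeaklyRegular.nil _ _
    | succ i ih =>
      intro hi
      obtain ⟨F, _, _, M, φ, hgood⟩ := ih (by omega)
      have hnot' := hnot i F M φ hgood (by omega)
      obtain ⟨_, _, hM, hφ, hφe, hreg⟩ := hgood
      obtain ⟨m, c, hc, hker⟩ := exists_minimal_cover (A := A) M
      obtain ⟨ψ, hψ⟩ := Module.projective_lifting_property c
        ((φ.comp d).codRestrict M hφ) hc
      have hψ' : ∀ x, ((c (ψ x) : M) : F) = φ (d x) := fun x =>
        congrArg Subtype.val (LinearMap.congr_fun hψ x)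
      refine ⟨Fin m → A, inferInstance, inferInstance, LinearMap.ker c, ψ, inferInstance,
        inferInstance, hker, fun x => ?_, fun hmem => ?_, ?_⟩
      · rw [LinearMap.mem_ker]
        apply Subtype.ext
        rw [hψ', hdd, map_zero]
        rfl
      -- If `ψ (e (i + 1))` lay in `𝔪` times the cover, its image would lie in `𝔪 M ⊆ 𝔪 ^ 2 F`.
      · apply hnot'
        rw [← hψ']
        have h2 : (M.subtype.comp c) (ψ (e (i + 1))) ∈ maximalIdeal A • M := by
          have h3 := Submodule.mem_map_of_mem (f := M.subtype.comp c) hmem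
          rw [Submodule.map_smul''] at h3
          refine Submodule.smul_mono le_rfl ?_ h3
          rintro _ ⟨z, _, rfl⟩
          exact (c z).2
        rw [pow_two, Submodule.mul_smul]
        exact Submodule.smul_mono le_rfl hM h2
      · obtain ⟨h1, h2, h3⟩ := hexact F M
        let eq : TensorProduct A B ((Fin m → A) ⧸ LinearMap.ker c) ≃ₗ[B] TensorProduct A B M :=
          (c.quotKerEquivOfSurjective hc).baseChange A B _ _
        rw [eq.isWeaklyRegular_congr, List.take_succ_eq_append_getElem (by omega)]
        refine IsWeaklyRegular.of_exact h1 h2 h3 ?_ hreg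
        rw [← List.take_succ_eq_append_getElem]
        have hflat : IsWeaklyRegular (TensorProduct B (TensorProduct A B F) B) rs :=
          hrs.isWeaklyRegular_lTensor
        rw [(TensorProduct.rid B (TensorProduct A B F)).isWeaklyRegular_congr] at hflat
        rw [← List.take_append_drop (i + 1) rs, isWeaklyRegular_append_iff] at hflat
        exact hflat.1
  obtain ⟨F, _, _, M, φ, hgood⟩ := hstep rs.length le_rfl
  have hnot' := hnot _ F M φ hgood hlt
  obtain ⟨_, _, hM, hφ, hφe, hreg⟩ := hgood
  rw [List.take_length] at hreg
  obtain ⟨h1, h2, h3⟩ := hexact F M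
  -- At full depth, `M ⊗ B` meets `𝔪_B (F ⊗ B)` only in `𝔪_B (M ⊗ B)`; as it is contained in the
  -- former, Nakayama kills it.
  have hall : ∀ x : TensorProduct A B M, x ∈ maximalIdeal B • (⊤ : Submodule B _) := by
    intro x
    rw [← hmax]
    refine hreg.mem_ofList_smul_top h1 h2 h3 ?_
    rw [hmax]
    induction x with
    | zero => rw [map_zero]; exact zero_mem _
    | add x y hx hy => rw [map_add]; exact add_mem hx hy
    | tmul b z =>
      rw [LinearMap.baseChange_tmul]
      have hz : ∀ y ∈ maximalIdeal A • (⊤ : Submodule A F),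
          (1 : B) ⊗ₜ[A] y ∈ maximalIdeal B • (⊤ : Submodule B (TensorProduct A B F)) := by
        intro y hy
        refine Submodule.smul_induction_on hy (fun r hr t _ => ?_) (fun s t hs ht => ?_)
        · have hrt : (1 : B) ⊗ₜ[A] (r • t) = algebraMap A B r • ((1 : B) ⊗ₜ[A] t) := by
            rw [algebraMap_smul, TensorProduct.tmul_smul]
          rw [hrt]
          exact Submodule.smul_mem_smul (map_nonunit (algebraMap A B) r hr) Submodule.mem_top
        · rw [TensorProduct.tmul_add]
          exact add_mem hs ht
      have := Submodule.smul_mem _ b (hz z (hM z.2))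
      rwa [TensorProduct.smul_tmul', smul_eq_mul, mul_one] at this
  have hfin : Module.Finite A M := inferInstance
  have htop : (⊤ : Submodule B (TensorProduct A B M)) = ⊥ :=
    Submodule.eq_bot_of_le_smul_of_le_jacobson_bot (maximalIdeal B) _ Module.Finite.fg_top
      (fun x _ => hall x) (maximalIdeal_le_jacobson _)
  have hsub : Subsingleton (TensorProduct A B M) := (Submodule.subsingleton_iff B).1
    (subsingleton_of_bot_eq_top htop.symm)
  have hsubM : Subsingleton M := (Module.FaithfullyFlat.subsingleton_tensorProduct_iff_right A B).1 hsub
  apply hnot'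
  have h0 : φ (d (e (rs.length + 1))) = 0 :=
    congrArg Subtype.val (Subsingleton.elim (⟨_, hφ _⟩ : M) 0)
  rw [h0]
  exact zero_mem _

/-- By incomparability, contraction of primes is strictly monotone. -/
theorem ringKrullDim_le_of_isIntegral (A : Type u) (B : Type v) [CommRing A] [CommRing B]
    [Algebra A B] [Algebra.IsIntegral A B] : ringKrullDim B ≤ ringKrullDim A :=
  Order.krullDim_le_of_strictMono (PrimeSpectrum.comap (algebraMap A B))
    fun I _ hIJ => Ideal.IsIntegral.comap_lt_comap (I := I.asIdeal) hIJ

/-- Regularity descends along integral faithfully flat local homomorphisms. -/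
theorem IsRegularLocalRing.of_faithfullyFlat_of_isIntegral (A B : Type u) [CommRing A]
    [IsLocalRing A] [CommRing B] [IsRegularLocalRing B] [Algebra A B] [Module.FaithfullyFlat A B]
    [IsLocalHom (algebraMap A B)] [Algebra.IsIntegral A B] : IsRegularLocalRing A := by
  have := isNoetherianRing_of_faithfullyFlat A B
  have hd := IsRegularLocalRing.spanFinrank_maximalIdeal (R := B)
  obtain ⟨rs, hlen, hmax, hrs⟩ := IsRegularLocalRing.exists_isWeaklyRegular _ B hd.symm
  refine .of_spanFinrank_maximalIdeal_le A ?_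
  refine le_trans ?_ (ringKrullDim_le_of_isIntegral A B)
  rw [← hd, Nat.cast_le, ← hlen]
  exact spanFinrank_maximalIdeal_le_length hrs hmax

end FlatDescent

/-! ### Pseudo-reflections -/

section PseudoReflection

open IsLocalRing Polynomial

variable {G B : Type*} [Group G] [CommRing B] [MulSemiringAction G B]

theorem exists_sub_mem_maximalIdeal [IsLocalRing B]
    (h : Function.Surjective (residueFieldMap G B)) (b : B) :
    ∃ a : InvariantRing G B, b - a ∈ maximalIdeal B := by
  obtain ⟨α, hα⟩ := h (residue B b)
  obtain ⟨a, rfl⟩ := residue_surjective α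
  refine ⟨a, ?_⟩
  rw [← residue_eq_zero_iff, map_sub, ← hα, sub_eq_zero]
  rfl

/-- If the maximal ideal is generated by `x` and by invariants, then `σ x - x` generates the
augmentation ideal. -/
theorem augmentationIdeal_eq_span_of_generators [IsLocalRing B] [IsNoetherianRing B]
    (h : Function.Surjective (residueFieldMap G B)) {σ : G} {x : B} {T : Set B}
    (hT : ∀ t ∈ T, σ • t = t) (hspan : Ideal.span (insert x T) = maximalIdeal B) :
    augmentationIdeal B σ = Ideal.span {σ • x - x} := by
  refine le_antisymm ?_
    ((Ideal.span_singleton_le_iff_mem _).2 (smul_sub_mem_augmentationIdeal σ x))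
  refine Submodule.le_of_le_smul_of_le_jacobson_bot (I := maximalIdeal B)
    (augmentationIdeal B σ).fg_of_isNoetherianRing (maximalIdeal_le_jacobson _) ?_
  -- The identity `σ(cz) - cz = σ(c)(σ z - z) + z(σ c - c)` reduces this, modulo `𝔪 I`, to the
  -- generators of `𝔪`.
  have hmax : ∀ z ∈ maximalIdeal B, σ • z - z ∈
      Ideal.span {σ • x - x} ⊔ maximalIdeal B • augmentationIdeal B σ := by
    intro z hz
    rw [← hspan] at hz
    induction hz using Submodule.span_induction with
    | mem z hz =>
      rcases hz with rfl | hz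
      · exact Ideal.mem_sup_left (Ideal.mem_span_singleton_self _)
      · rw [hT z hz, sub_self]
        exact zero_mem _
    | zero => simp
    | add z w _ _ hz hw =>
      rw [smul_add, add_sub_add_comm]
      exact add_mem hz hw
    | smul c z hz' hz =>
      have hz'' : z ∈ maximalIdeal B := hspan ▸ hz'
      have : σ • (c • z) - c • z = σ • c * (σ • z - z) + z * (σ • c - c) := by
        rw [smul_eq_mul, smul_mul']
        ring
      rw [this]
      exact add_mem (Ideal.mul_mem_left _ _ hz) (Ideal.mem_sup_right
        (Ideal.mul_mem_mul hz'' (smul_sub_mem_augmentationIdeal σ c)))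
  refine Ideal.span_le.2 ?_
  rintro _ ⟨b, rfl⟩
  obtain ⟨a, ha⟩ := exists_sub_mem_maximalIdeal h b
  have hb := hmax _ ha
  rw [smul_sub, show σ • (a : B) = a from a.2 σ, sub_sub_sub_cancel_right] at hb
  exact hb

theorem isPrincipal_augmentationIdeal_of_isPseudoReflection [IsRegularLocalRing B]
    (h : Function.Surjective (residueFieldMap G B)) (σ : G) (hG : IsPseudoReflection G B) :
    (augmentationIdeal B σ).IsPrincipal := by
  obtain ⟨d, y, -, hspan, hinv⟩ := hG
  rcases d with - | d
  -- With no parameters there is no `y 0`; zero replaces it.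
  · refine ⟨_, augmentationIdeal_eq_span_of_generators h (x := 0) (T := Set.range y) ?_ ?_⟩
    · rintro _ ⟨i, rfl⟩
      exact i.elim0
    · rw [Ideal.span_insert_zero, hspan]
  · refine ⟨_, augmentationIdeal_eq_span_of_generators h (x := y 0)
      (T := Set.range (y ∘ Fin.succ)) ?_ ?_⟩
    · rintro _ ⟨i, rfl⟩
      exact hinv _ (by simp) σ
    · rw [← hspan, ← Fin.cons_self_tail y, Fin.range_cons]
      rfl

/-- If `P(y) ∈ 𝔪` and `y ∈ 𝔪`, the constant term of `P` is an invariant in `𝔪`. -/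
theorem span_insert_invariants_eq_maximalIdeal [IsLocalRing B] {y : B}
    (hy : Algebra.adjoin (InvariantRing G B) {y} = ⊤) (hym : y ∈ maximalIdeal B) :
    Ideal.span (insert y {t | t ∈ maximalIdeal B ∧ ∀ g : G, g • t = t}) = maximalIdeal B := by
  refine le_antisymm (Ideal.span_le.2 (Set.insert_subset hym fun t ht => ht.1)) fun b hb => ?_
  have hb' : b ∈ Algebra.adjoin (InvariantRing G B) {y} := hy ▸ Algebra.mem_top
  rw [Algebra.adjoin_singleton_eq_range_aeval] at hb'
  obtain ⟨P, rfl⟩ := hb'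
  change aeval y P ∈ _ at hb
  change aeval y P ∈ _
  have hP : aeval y P = y * aeval y P.divX + algebraMap (InvariantRing G B) B (P.coeff 0) := by
    conv_lhs => rw [← X_mul_divX_add P]
    rw [map_add, map_mul, aeval_X, aeval_C]
  have hc : algebraMap (InvariantRing G B) B (P.coeff 0) ∈ maximalIdeal B := by
    rw [← sub_eq_iff_eq_add'.2 hP]
    exact sub_mem hb (Ideal.mul_mem_right _ _ hym)
  rw [hP]
  refine add_mem (Ideal.mul_mem_right _ _ (Ideal.subset_span (Set.mem_insert _ _))) ?_
  exact Ideal.subset_span (Set.mem_insert_of_mem _ ⟨hc, fun g => (P.coeff 0).2 g⟩)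

theorem isPseudoReflection_of_span_insert [IsRegularLocalRing B] {x : B} {T : Set B}
    (hTm : T ⊆ maximalIdeal B) (hT : ∀ t ∈ T, ∀ g : G, g • t = t) (hx : x ∈ maximalIdeal B)
    (hx2 : x ∉ maximalIdeal B ^ 2) (hspan : Ideal.span (insert x T) = maximalIdeal B) :
    IsPseudoReflection G B := by
  obtain ⟨n, f, hf, hfspan, hn⟩ := exists_minimal_generators_insert hTm hx hx2 hspan
  refine ⟨n + 1, Fin.cons x f, ?_, ?_, ?_⟩
  · rw [← hn, IsRegularLocalRing.spanFinrank_maximalIdeal]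
  · rw [Fin.range_cons, hfspan]
  · intro i hi g
    obtain ⟨j, rfl⟩ := Fin.exists_succ_eq.2 (fun h : i = 0 => hi (by simp [h]))
    rw [Fin.cons_succ]
    exact hT _ (hf j) g

/-- If `y ∉ 𝔪 ^ 2`, complete it by invariants. Otherwise the invariants alone generate `𝔪` by
Nakayama, and one outside `𝔪 ^ 2` takes the place of `y`, unless `𝔪 = 0`. -/
theorem isPseudoReflection_of_adjoin_eq_top [IsRegularLocalRing B] {y : B}
    (hy : Algebra.adjoin (InvariantRing G B) {y} = ⊤) (hym : y ∈ maximalIdeal B) :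
    IsPseudoReflection G B := by
  have hspan := span_insert_invariants_eq_maximalIdeal hy hym
  set T : Set B := {t | t ∈ maximalIdeal B ∧ ∀ g : G, g • t = t}
  by_cases hy2 : y ∈ maximalIdeal B ^ 2
  · have hTspan : Ideal.span T = maximalIdeal B := by
      refine le_antisymm (Ideal.span_le.2 fun t ht => ht.1) ?_
      refine Submodule.le_of_le_smul_of_le_jacobson_bot (I := maximalIdeal B)
        (maximalIdeal B).fg_of_isNoetherianRing (maximalIdeal_le_jacobson _) ?_
      rw [smul_eq_mul, ← pow_two, sup_comm]
      refine hspan.ge.trans ?_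
      rw [Ideal.span_insert]
      exact sup_le_sup_right ((Ideal.span_singleton_le_iff_mem _).2 hy2) _
    by_cases hTle : T ⊆ (maximalIdeal B ^ 2 : Ideal B)
    · have h0 := maximalIdeal_eq_bot_of_le_sq (hTspan.ge.trans (Ideal.span_le.2 hTle))
      refine ⟨0, Fin.elim0, ?_, ?_, fun i => i.elim0⟩
      · rw [← IsRegularLocalRing.spanFinrank_maximalIdeal, h0, Submodule.spanFinrank_bot]
      · rw [h0, Set.range_eq_empty, Ideal.span_empty]
    · obtain ⟨x, hxT, hx2⟩ := Set.not_subset.1 hTle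
      exact isPseudoReflection_of_span_insert (T := T) (fun t ht => ht.1) (fun t ht => ht.2)
        hxT.1 hx2 (by rw [Set.insert_eq_of_mem hxT, hTspan])
  · exact isPseudoReflection_of_span_insert (T := T) (fun t ht => ht.1) (fun t ht => ht.2) hym hy2
      hspan

end PseudoReflection

/-! ### Regularity of the invariants and conclusion -/

section Regular

universe u v

variable {G : Type v} {B : Type u} [Group G] [CommRing B] [MulSemiringAction G B]

instance invariantRing_isInvariant : Algebra.IsInvariant (InvariantRing G B) B G where
  isInvariant b hb := ⟨⟨b, hb⟩, rfl⟩

theorem isRegularLocalRing_invariantRing [Finite G] [IsRegularLocalRing B]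
    [Module.Free (InvariantRing G B) B] : IsRegularLocalRing (InvariantRing G B) := by
  have : Algebra.IsIntegral (InvariantRing G B) B := Algebra.IsInvariant.isIntegral _ _ G
  exact IsRegularLocalRing.of_faithfullyFlat_of_isIntegral (InvariantRing G B) B

end Regular

theorem theorem1 {G B : Type*} [CommRing B] [IsDomain B] [IsIntegrallyClosed B] [IsLocalRing B]
    [Group G] [MulSemiringAction G B] [FaithfulSMul G B]
    (p : ℕ) (hp : p.Prime) (hG : Nat.card G = p)
    (σ : G) (hσ : Subgroup.zpowers σ = ⊤) :
    -- (a) if and only if (b)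
    ((augmentationIdeal B σ).IsPrincipal ↔ IsMonogenous (InvariantRing G B) B) ∧
    -- (b) implies (c)
    (IsMonogenous (InvariantRing G B) B → Module.Free (InvariantRing G B) B) ∧
    -- the part where `B` is regular
    (∀ [IsRegularLocalRing B],
      -- (c) implies (d)
      (Module.Free (InvariantRing G B) B → IsRegularLocalRing (InvariantRing G B)) ∧
      -- (a) if and only if (e), when the residue fields agree
      (Function.Bijective (residueFieldMap G B) →
        ((augmentationIdeal B σ).IsPrincipal ↔ IsPseudoReflection G B))) := by
  have hσp := orderOf_eq_of_zpowers_eq_top hG hσ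
  have : Finite G := Nat.finite_of_card_ne_zero (hG ▸ hp.ne_zero)
  refine ⟨⟨fun h => ?_, fun ⟨y, hy⟩ => ?_⟩, fun ⟨y, hy⟩ => ?_, ?_⟩
  · obtain ⟨y, hy⟩ := exists_augmentationIdeal_eq_span h
    exact ⟨y, adjoin_eq_top_of_augmentationIdeal_eq_span hp hσp hσ hy⟩
  · exact ⟨_, augmentationIdeal_eq_span_of_adjoin_eq_top hy⟩
  · exact free_of_augmentationIdeal_eq_span hp hσp hσ
      (augmentationIdeal_eq_span_of_adjoin_eq_top hy)
  · intro _
    refine ⟨fun h => isRegularLocalRing_invariantRing, fun hk => ⟨fun h => ?_,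
      isPrincipal_augmentationIdeal_of_isPseudoReflection hk.2 σ⟩⟩
    obtain ⟨y, hy⟩ := exists_augmentationIdeal_eq_span h
    -- Subtracting an invariant moves `y` into `𝔪` without changing `σ y - y`.
    obtain ⟨a, ha⟩ := exists_sub_mem_maximalIdeal hk.2 y
    refine isPseudoReflection_of_adjoin_eq_top
      (adjoin_eq_top_of_augmentationIdeal_eq_span hp hσp hσ (y := y - a) ?_) ha
    rw [hy, smul_sub, show σ • (a : B) = a from a.2 σ, sub_sub_sub_cancel_right]
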